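/- Let $\Delta$ be a finite reduced crystallographic root system spanning the real vector space $\mathfrak t^*$ (the root system of a semisimple Lie algebra), with positive roots $\Delta^+$, negative roots $\Delta^-=-\Delta^+$, Weyl group $W$, length function $\ell$ and strong Bruhat order $\preccurlyeq$ determined by a choice of simple roots. Let $\mathbb S(\mathfrak t^*)$ be the symmetric algebra of $\mathfrak t^*$, graded with $\mathfrak t^*$ in degree $2$ and with the natural action of $W$, and let $H_\alpha(W)$ be the $\mathbb S(\mathfrak t^*)$-module of all maps $f\colon W\to\mathbb S(\mathfrak t^*)$ such that $f(ws_\beta)-f(w)\in (w\beta)\,\mathbb S(\mathfrak t^*)$ for all $w\in W$, $\beta\in\Delta^+$. The group $W$ acts on $H_\alpha(W)$ by $f\mapsto f^w$, $f^w(v)=w^{-1}\cdot f(wv)$, and we put $f^{sym}=\frac1{|W|}\sum_{w\in W}f^w$. The left weak order is defined by $v\leqslant_L u \Longleftrightarrow \ell(uv^{-1})=\ell(u)-\ell(v)$. For every $u\in W$ there is a unique $\tau_u\in H_\alpha(W)$ (the equivariant Schubert class of $u$) such that all values of $\tau_u$ are homogeneous of degree $2\ell(u)$, $\tau_u$ is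 supported on $\{v : u\preccurlyeq v\}$, and $\tau_u(u)=\prod\{\beta : \beta\in\Delta^+,\ u^{-1}\beta\in\Delta^-\}$; and $\{\tau_u : u\in W\}$ is a basis of the $\mathbb S(\mathfrak t^*)$-module $H_\alpha(W)$. Theorem. Let $\tau_u^{sym}$ be the symmetrization of $\tau_u$, and let $\tau_u^{sym}=\sum_{v\in W}a_{u,v}\tau_v$, with $a_{u,v}\in\mathbb S(\mathfrak t^*)$, be its decomposition in the Schubert basis. Then: 1. $a_{u,v}\neq 0 \Longrightarrow v\leqslant_L u$ for all $u,v\in W$; 2. $a_{u,u}=1$ for all $u\in W$; 3. $\{\tau_u^{sym} : u\in W\}$ is a basis of the $\mathbb S(\mathfrak t^*)$-module $H_\alpha(W)$, and it consists of $W$-invariant classes. -/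

import Mathlib

noncomputable section

namespace FlagGKM

variable {ι M N : Type*} [AddCommGroup M] [Module ℝ M] [AddCommGroup N] [Module ℝ N]

/-- The symmetric algebra `S(𝔱*)`, where `𝔱* = M` is the real vector space spanned by the roots. -/
abbrev Sym (_P : RootPairing ι ℝ M N) : Type _ := SymmetricAlgebra ℝ M

/-- The image in `S(𝔱*)` of the root with index `i`. -/
def symRoot (P : RootPairing ι ℝ M N) (i : ι) : Sym P := SymmetricAlgebra.ι ℝ M (P.root i)

/-- The action of an element `w` of the Weyl group on `S(𝔱*)`: the algebra endomorphism extending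
the natural action of `w` on `𝔱*`. -/
def symAct (P : RootPairing ι ℝ M N) (w : P.weylGroup) : Sym P →ₐ[ℝ] Sym P :=
  SymmetricAlgebra.lift (SymmetricAlgebra.ι ℝ M ∘ₗ P.weylGroupRootRep w)

theorem symAct_symRoot (P : RootPairing ι ℝ M N) (w : P.weylGroup) (i : ι) :
    symAct P w (symRoot P i) = symRoot P (w • i) := by
  unfold symAct symRoot
  rw [SymmetricAlgebra.lift_ι_apply]
  exact congrArg (SymmetricAlgebra.ι ℝ M) (P.weylGroup_apply_root w i)

/-- The reflection `s_β` in the root `β` with index `i`, as an element of the Weyl group. -/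
abbrev refl (P : RootPairing ι ℝ M N) (i : ι) : P.weylGroup := RootPairing.weylGroup.ofIdx P i

/-- The Weyl group of a finite root system is finite. -/
instance finite_weylGroup (P : RootPairing ι ℝ M N) [Finite ι] [P.IsRootSystem] :
    Finite P.weylGroup := by
  refine Finite.of_injective (fun w : P.weylGroup => (fun i : ι => w • i)) fun w w' h => ?_
  refine Subtype.ext (RootPairing.Equiv.weightHom_injective P (LinearEquiv.toLinearMap_injective ?_))
  refine LinearMap.ext_on_range (v := P.root) RootPairing.IsRootSystem.span_root_eq_top fun i => ?_
  have h1 : w • P.root i = w' • P.root i := by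
    rw [P.weylGroup_apply_root, P.weylGroup_apply_root]
    exact congrArg P.root (congrFun h i)
  exact h1

instance fintype_weylGroup (P : RootPairing ι ℝ M N) [Finite ι] [P.IsRootSystem] :
    Fintype P.weylGroup := Fintype.ofFinite _

/-- The equivariant (GKM) cohomology `H_α(W)` of the GKM graph of the full flag manifold: the maps
`f : W → S(𝔱*)` with `f (w s_β) - f w ∈ (wβ) S(𝔱*)` for all `w ∈ W` and all roots `β`
(as `s_{-β} = s_β`, it is the same to take only positive `β`). -/
def cohomology (P : RootPairing ι ℝ M N) : Submodule (Sym P) (P.weylGroup → Sym P) where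
  carrier := {f | ∀ (w : P.weylGroup) (i : ι), symRoot P (w • i) ∣ f (w * refl P i) - f w}
  zero_mem' := fun w i => by simp
  add_mem' := by
    intro f g hf hg w i
    have h := dvd_add (hf w i) (hg w i)
    simpa only [Pi.add_apply, add_sub_add_comm] using h
  smul_mem' := by
    intro c f hf w i
    have h := (hf w i).mul_left c
    simpa only [Pi.smul_apply, smul_eq_mul, mul_sub] using h

/-- The permuted map `f^w = w · f`, `f^w (v) = w⁻¹ (f (w v))`. -/
def permuteFun (P : RootPairing ι ℝ M N) (w : P.weylGroup) (f : P.weylGroup → Sym P) :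
    P.weylGroup → Sym P :=
  fun v => symAct P w⁻¹ (f (w * v))

theorem permuteFun_mem (P : RootPairing ι ℝ M N) (w : P.weylGroup) {f : P.weylGroup → Sym P}
    (hf : f ∈ cohomology P) : permuteFun P w f ∈ cohomology P := by
  intro v i
  obtain ⟨g, hg⟩ := hf (w * v) i
  refine ⟨symAct P w⁻¹ g, ?_⟩
  unfold permuteFun
  rw [← map_sub, ← mul_assoc, hg, map_mul, symAct_symRoot, smul_smul, inv_mul_cancel_left]

/-- The action of the Weyl group on classes, `f ↦ f^w`. -/
def permute (P : RootPairing ι ℝ M N) (w : P.weylGroup) (f : cohomology P) : cohomology P :=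
  ⟨permuteFun P w f, permuteFun_mem P w f.2⟩

/-- The symmetrized class `f^sym = (1 / |W|) ∑_{w ∈ W} f^w`. -/
def symmetrize (P : RootPairing ι ℝ M N) [Finite ι] [P.IsRootSystem] (f : cohomology P) :
    cohomology P :=
  (Fintype.card P.weylGroup : ℝ)⁻¹ • ∑ w : P.weylGroup, permute P w f

/-- A class is `W`-invariant. -/
def IsInvariant (P : RootPairing ι ℝ M N) (f : cohomology P) : Prop :=
  ∀ w : P.weylGroup, permute P w f = f

section Base

variable {P : RootPairing ι ℝ M N} (b : P.Base)

/-- The length of `w`: the least length of a word in the simple reflections representing `w`. -/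
def length (w : P.weylGroup) : ℕ :=
  sInf {n | ∃ l : List b.support, l.length = n ∧ (l.map fun i => refl P i.1).prod = w}

/-- The strong Bruhat order: the reflexive transitive closure of `v → v s_β` for roots `β` with
`ℓ(v) < ℓ(v s_β)`. -/
def BruhatLE (u v : P.weylGroup) : Prop :=
  Relation.ReflTransGen
    (fun x y : P.weylGroup => (∃ i : ι, y = x * refl P i) ∧ length b x < length b y) u v

/-- The left weak order: `v ≤_L u` iff `ℓ(u v⁻¹) = ℓ(u) - ℓ(v)`. -/
def LeftWeakLE (v u : P.weylGroup) : Prop :=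
  (length b (u * v⁻¹) : ℤ) = (length b u : ℤ) - (length b v : ℤ)

/-- The (indices of) positive roots `β` such that `u⁻¹ β` is negative. -/
def inversions [Finite ι] (u : P.weylGroup) : Finset ι :=
  (Set.toFinite {i : ι | b.IsPos i ∧ ¬ b.IsPos (u⁻¹ • i)}).toFinset

/-- The conditions that characterize the equivariant Schubert class of `u`. In `homogeneous`, the
polynomial degree is used; as elements of `𝔱*` have cohomological degree `2`, this is
cohomological degree `2 ℓ(u)`. -/
structure IsSchubertClass [Finite ι] (u : P.weylGroup) (f : cohomology P) : Prop where
  homogeneous : ∀ v, f.1 v ∈ LinearMap.range (SymmetricAlgebra.ι ℝ M) ^ length b u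
  support : ∀ v, f.1 v ≠ 0 → BruhatLE b u v
  normalized : f.1 u = ∏ i ∈ inversions b u, symRoot P i

open Classical in
/-- The equivariant Schubert class `τ_u`: the class satisfying `IsSchubertClass b u`
(and `0` should there be none). -/
def schubertClass [Finite ι] (u : P.weylGroup) : cohomology P :=
  if h : ∃ f : cohomology P, IsSchubertClass b u f then h.choose else 0

end Base

end FlagGKM

end

/-! The proof rests on the left divided differences `divDiff`, f ↦ (f - f^{s_i}) / α_i. They act on
classes, lower the degree by one, and take s_i-invariant values. For s_i u longer than u they send
τ_{s_i u} to τ_u (`IsSchubertClass.divDiff`), so all Schubert classes descend from a class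
concentrated at the longest element.

Uniqueness and spanning come from `prod_inversions_dvd`: a class vanishing on all elements shorter
than u has a value at u divisible by the product of the inversions of u, which has polynomial degree
ℓ(u).

Hence s_i fixes τ_u when s_i u is longer, and otherwise τ_u^{s_i} = τ_u - α_i τ_{s_i u}, where s_i u
lies below u in the left weak order. The span of the τ_v with v strictly below u is thus stable
under W and contains every τ_u^w - τ_u (`permute_schubertClass_sub_mem`). Averaging over w makes the
transition matrix unitriangular, hence invertible. -/

noncomputable section

namespace FlagGKM

variable {ι M N : Type*} [AddCommGroup M] [Module ℝ M] [AddCommGroup N] [Module ℝ N]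

/-! ### Reflections and their conjugates in the Weyl group. -/

section Weyl

variable (P : RootPairing ι ℝ M N)

theorem root_smul (w : P.weylGroup) (i : ι) : P.root (w • i) = w • P.root i :=
  (P.weylGroup_apply_root w i).symm

theorem refl_smul (i j : ι) : refl P i • j = P.reflectionPerm i j := rfl

theorem refl_smul_vec (i : ι) (m : M) : refl P i • m = P.reflection i m := rfl

theorem weylGroup_ext {w w' : P.weylGroup} (h : ∀ m : M, w • m = w' • m) : w = w' :=
  Subtype.ext (RootPairing.Equiv.weightHom_injective P (LinearEquiv.ext h))

@[simp]
theorem refl_mul_refl (i : ι) : refl P i * refl P i = 1 :=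
  weylGroup_ext P fun m => by
    rw [mul_smul, refl_smul_vec, refl_smul_vec, one_smul, P.reflection_same]

@[simp]
theorem refl_inv (i : ι) : (refl P i)⁻¹ = refl P i :=
  inv_eq_of_mul_eq_one_left (refl_mul_refl P i)

@[simp]
theorem refl_mul_refl_mul (i : ι) (w : P.weylGroup) : refl P i * (refl P i * w) = w := by
  rw [← mul_assoc, refl_mul_refl, one_mul]

@[simp]
theorem refl_smul_refl_smul (i j : ι) : refl P i • refl P i • j = j := by
  rw [smul_smul, refl_mul_refl, one_smul]

theorem refl_refl_smul (i j : ι) : refl P (refl P i • j) = refl P i * refl P j * refl P i :=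
  weylGroup_ext P fun m => by
    simp only [mul_smul, refl_smul_vec, refl_smul, P.reflection_reflectionPerm]
    rfl

theorem refl_conj (w : P.weylGroup) (i : ι) : refl P (w • i) = w * refl P i * w⁻¹ := by
  obtain ⟨w, hw⟩ := w
  induction hw using RootPairing.weylGroup.induction generalizing i with
  | mem j =>
    exact (refl_refl_smul P j i).trans
      (congrArg (fun x => refl P j * refl P i * x) (refl_inv P j).symm)
  | one =>
    exact (congrArg (refl P) (one_smul P.weylGroup i)).trans (by
      change _ = (1 : P.weylGroup) * _ * (1 : P.weylGroup)⁻¹; simp)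
  | mul x y hx hy ihx ihy =>
    have h : (⟨x * y, mul_mem hx hy⟩ : P.weylGroup) = ⟨x, hx⟩ * ⟨y, hy⟩ := rfl
    rw [h, mul_smul, ihx, ihy]
    group

theorem refl_smul_mul (w : P.weylGroup) (i : ι) : refl P (w • i) * w = w * refl P i := by
  rw [refl_conj, inv_mul_cancel_right]

/-- Hence `refl P i • i` serves throughout as the index of the opposite root. -/
theorem root_refl_self (i : ι) : P.root (refl P i • i) = -P.root i := by
  rw [refl_smul, P.root_reflectionPerm, P.reflection_apply_self]

theorem smul_refl_self (w : P.weylGroup) (i : ι) :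
    w • refl P i • i = refl P (w • i) • w • i := by
  apply P.root.injective
  rw [root_refl_self, root_smul, root_refl_self, root_smul, smul_neg]

theorem refl_refl_self (i : ι) : refl P (refl P i • i) = refl P i := by
  rw [refl_refl_smul, mul_assoc, refl_mul_refl, mul_one]

end Weyl

/-! ### Words, the exchange property, and length as the number of inversions. -/

section Length

variable {P : RootPairing ι ℝ M N} (b : P.Base)

theorem isPos_refl_self {i : ι} : b.IsPos (refl P i • i) ↔ ¬ b.IsPos i :=
  RootPairing.Base.IsPos.neg_iff_not b i

theorem isPos_smul_refl_self {w : P.weylGroup} {i : ι} :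
    b.IsPos (w • refl P i • i) ↔ ¬ b.IsPos (w • i) := by
  rw [smul_refl_self, isPos_refl_self]

variable {b} in
theorem isPos_refl_smul [Finite ι] [P.IsCrystallographic] [P.IsReduced] {i j : ι}
    (hi : i ∈ b.support) (hj : b.IsPos j) (hji : j ≠ i) : b.IsPos (refl P i • j) :=
  hj.reflectionPerm hi hji

/-- The product of the simple reflections in a word. -/
def wordProd (l : List b.support) : P.weylGroup := (l.map fun i => refl P i.1).prod

@[simp]
theorem wordProd_nil : wordProd b [] = 1 := rfl

@[simp]
theorem wordProd_cons (i : b.support) (l : List b.support) :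
    wordProd b (i :: l) = refl P i.1 * wordProd b l := by
  simp [wordProd]

theorem wordProd_append (l l' : List b.support) :
    wordProd b (l ++ l') = wordProd b l * wordProd b l' := by
  simp [wordProd]

variable [Finite ι] [P.IsCrystallographic] [P.IsReduced]

theorem exists_word_refl (i : ι) : ∃ l, wordProd b l = refl P i := by
  refine b.induction_reflect i (p := fun i => ∃ l, wordProd b l = refl P i) ?_ ?_ ?_
  · rintro i ⟨l, hl⟩
    exact ⟨l, hl.trans (refl_refl_self P i).symm⟩
  · exact fun i hi => ⟨[⟨i, hi⟩], by simp⟩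
  · rintro i j ⟨l, hl⟩ hj
    refine ⟨⟨j, hj⟩ :: (l ++ [⟨j, hj⟩]), ?_⟩
    rw [wordProd_cons, wordProd_append, hl]
    refine Eq.trans ?_ (refl_refl_smul P j i).symm
    simp [mul_assoc]

theorem exists_word (w : P.weylGroup) : ∃ l, wordProd b l = w := by
  obtain ⟨w, hw⟩ := w
  induction hw using RootPairing.weylGroup.induction with
  | mem i => exact exists_word_refl b i
  | one => exact ⟨[], rfl⟩
  | mul x y hx hy ihx ihy =>
    obtain ⟨l, hl⟩ := ihx
    obtain ⟨l', hl'⟩ := ihy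
    exact ⟨l ++ l', by rw [wordProd_append, hl, hl']; rfl⟩

theorem exists_reduced_word (w : P.weylGroup) : ∃ l, l.length = length b w ∧ wordProd b l = w := by
  obtain ⟨l, hl⟩ := exists_word b w
  exact Nat.sInf_mem (s := {n | ∃ l : List b.support, l.length = n ∧ wordProd b l = w})
    ⟨l.length, l, rfl, hl⟩

omit [Finite ι] [P.IsCrystallographic] [P.IsReduced] in
theorem length_wordProd_le (l : List b.support) : length b (wordProd b l) ≤ l.length :=
  Nat.sInf_le ⟨l, rfl, rfl⟩

theorem length_refl_mul_le (i : b.support) (w : P.weylGroup) :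
    length b (refl P i.1 * w) ≤ length b w + 1 := by
  obtain ⟨l, hl, rfl⟩ := exists_reduced_word b w
  rw [← hl, ← wordProd_cons]
  exact length_wordProd_le b (i :: l)

theorem length_le_refl_mul (i : b.support) (w : P.weylGroup) :
    length b w ≤ length b (refl P i.1 * w) + 1 := by
  simpa using length_refl_mul_le b i (refl P i.1 * w)

theorem length_mul_le (v w : P.weylGroup) : length b (v * w) ≤ length b v + length b w := by
  obtain ⟨l, hl, rfl⟩ := exists_reduced_word b v
  obtain ⟨l', hl', rfl⟩ := exists_reduced_word b w
  rw [← hl, ← hl', ← wordProd_append, ← List.length_append]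
  exact length_wordProd_le b _

/-- The strong exchange property. Push j through the word letter by letter: a simple reflection
permutes the positive roots other than its own, so j can only turn negative on meeting its own
letter, and that letter is erased. -/
theorem exists_word_erase (l : List b.support) {j : ι} (hj : b.IsPos j)
    (h : ¬ b.IsPos ((wordProd b l)⁻¹ • j)) :
    ∃ l' : List b.support, l'.length + 1 = l.length ∧ wordProd b l' = refl P j * wordProd b l := by
  induction l generalizing j with
  | nil => simp [hj] at h
  | cons i l ih =>
    by_cases hji : j = i.1
    · exact ⟨l, rfl, by simp [hji]⟩
    · obtain ⟨l', hl', hw⟩ := ih (isPos_refl_smul i.2 hj hji) (by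
        simpa [mul_smul] using h)
      refine ⟨i :: l', by simpa using hl', ?_⟩
      rw [wordProd_cons, wordProd_cons, hw, refl_refl_smul]
      simp [mul_assoc]

variable {b}

theorem length_refl_mul_lt {w : P.weylGroup} {j : ι} (hj : b.IsPos j)
    (h : ¬ b.IsPos (w⁻¹ • j)) : length b (refl P j * w) < length b w := by
  obtain ⟨l, hl, rfl⟩ := exists_reduced_word b w
  obtain ⟨l', hl', hw⟩ := exists_word_erase b l hj h
  have := length_wordProd_le b l'
  rw [hw] at this
  omega

theorem length_lt_refl_mul {w : P.weylGroup} {j : ι} (hj : b.IsPos j)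
    (h : b.IsPos (w⁻¹ • j)) : length b w < length b (refl P j * w) := by
  have := length_refl_mul_lt (w := refl P j * w) hj (by
    rw [mul_inv_rev, refl_inv, mul_smul, isPos_smul_refl_self]; simpa using h)
  simpa using this

theorem length_lt_refl_mul_iff {w : P.weylGroup} {j : ι} (hj : b.IsPos j) :
    length b w < length b (refl P j * w) ↔ b.IsPos (w⁻¹ • j) := by
  by_cases h : b.IsPos (w⁻¹ • j)
  · exact iff_of_true (length_lt_refl_mul hj h) h
  · exact iff_of_false (length_refl_mul_lt hj h).le.not_gt h

theorem length_refl_mul_lt_iff {w : P.weylGroup} {j : ι} (hj : b.IsPos j) :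
    length b (refl P j * w) < length b w ↔ ¬ b.IsPos (w⁻¹ • j) := by
  by_cases h : b.IsPos (w⁻¹ • j)
  · exact iff_of_false (length_lt_refl_mul hj h).le.not_gt (not_not.mpr h)
  · exact iff_of_true (length_refl_mul_lt hj h) h

omit [P.IsCrystallographic] [P.IsReduced] in
variable (b) in
theorem mem_inversions {u : P.weylGroup} {j : ι} :
    j ∈ inversions b u ↔ b.IsPos j ∧ ¬ b.IsPos (u⁻¹ • j) := by
  simp [inversions]

theorem length_refl_mul_eq {u : P.weylGroup} {i : b.support}
    (h : length b u < length b (refl P i.1 * u)) :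
    length b (refl P i.1 * u) = length b u + 1 :=
  le_antisymm (length_refl_mul_le b i u) h

open Classical in
-- s_i permutes the positive roots other than α_i. Besides counting inversions, this decomposition
-- gives the normalization of divided differences of Schubert classes.
theorem inversions_refl_mul {u : P.weylGroup} {i : b.support}
    (h : length b u < length b (refl P i.1 * u)) :
    inversions b (refl P i.1 * u) =
      insert i.1 ((inversions b u).image fun j => refl P i.1 • j) := by
  have hi := b.isPos_of_mem_support i.2
  rw [length_lt_refl_mul_iff hi] at h
  ext j
  rw [Finset.mem_insert, Finset.mem_image, mem_inversions, mul_inv_rev, refl_inv, mul_smul]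
  constructor
  · rintro ⟨h1, h2⟩
    by_cases hji : j = i.1
    · exact Or.inl hji
    · exact Or.inr ⟨refl P i.1 • j,
        (mem_inversions b).mpr ⟨isPos_refl_smul i.2 h1 hji, h2⟩, by simp⟩
  · rintro (rfl | ⟨k, hk, rfl⟩)
    · exact ⟨hi, by rw [isPos_smul_refl_self]; simpa using h⟩
    · rw [mem_inversions] at hk
      have hki : k ≠ i.1 := fun e => hk.2 (e ▸ h)
      exact ⟨isPos_refl_smul i.2 hk.1 hki, by simpa using hk.2⟩

omit [P.IsCrystallographic] [P.IsReduced] in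
theorem notMem_image_inversions {u : P.weylGroup} {i : b.support} [DecidableEq ι] :
    i.1 ∉ (inversions b u).image fun j => refl P i.1 • j := by
  rw [Finset.mem_image]
  rintro ⟨k, hk, hki⟩
  have h2 : k = refl P i.1 • i.1 := (inv_smul_eq_iff.mpr hki.symm).symm.trans (by rw [refl_inv])
  have h3 := ((mem_inversions b).mp hk).1
  rw [h2, isPos_refl_self] at h3
  exact h3 (b.isPos_of_mem_support i.2)

theorem exists_length_refl_mul_lt {w : P.weylGroup} (h : length b w ≠ 0) :
    ∃ i : b.support, length b (refl P i.1 * w) < length b w := by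
  obtain ⟨l, hl, rfl⟩ := exists_reduced_word b w
  cases l with
  | nil => simp_all
  | cons i l =>
    refine ⟨i, ?_⟩
    have := length_wordProd_le b l
    simp only [List.length_cons] at hl
    rw [← hl, wordProd_cons, refl_mul_refl_mul]
    omega

omit [Finite ι] [P.IsCrystallographic] [P.IsReduced] in
variable (b) in
@[simp]
theorem length_one : length b 1 = 0 :=
  Nat.le_zero.mp (length_wordProd_le b [])

theorem eq_one_of_length_eq_zero {w : P.weylGroup} (h : length b w = 0) : w = 1 := by
  obtain ⟨l, hl, rfl⟩ := exists_reduced_word b w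
  rw [List.length_eq_zero_iff.mp (hl.trans h), wordProd_nil]

variable (b) in
theorem card_inversions (w : P.weylGroup) : (inversions b w).card = length b w := by
  classical
  generalize hn : length b w = n
  induction n generalizing w with
  | zero =>
    rw [eq_one_of_length_eq_zero hn, Finset.card_eq_zero, Finset.eq_empty_iff_forall_notMem]
    intro j
    simp [mem_inversions]
  | succ n ih =>
    obtain ⟨i, hi⟩ := exists_length_refl_mul_lt (b := b) (w := w) (by omega)
    have h1 : length b (refl P i.1 * w) = n := by
      have := length_le_refl_mul b i w
      omega
    have h2 := inversions_refl_mul (u := refl P i.1 * w) (i := i) (by simpa using hi)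
    rw [refl_mul_refl_mul] at h2
    rw [h2, Finset.card_insert_of_notMem notMem_image_inversions,
      Finset.card_image_of_injective _ (MulAction.injective _), ih _ h1]

/-- An element that no simple reflection lengthens inverts all positive roots. -/
theorem not_isPos_of_forall_length_le {w : P.weylGroup}
    (h : ∀ i : b.support, length b (refl P i.1 * w) ≤ length b w) {j : ι} (hj : b.IsPos j) :
    ¬ b.IsPos (w⁻¹ • j) := by
  refine hj.induction_on_add (p := fun j => ¬ b.IsPos (w⁻¹ • j)) ?_ ?_
  · intro i hi hp
    exact (h ⟨i, hi⟩).not_gt (length_lt_refl_mul (b.isPos_of_mem_support hi) hp)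
  · intro i j k hk hi hj
    have h1 := (h ⟨j, hj⟩).not_gt
    rw [length_lt_refl_mul_iff (b.isPos_of_mem_support hj)] at h1
    -- Negativity becomes positivity of the opposite roots, which is closed under addition.
    rw [← isPos_refl_self, ← smul_refl_self] at hi h1 ⊢
    refine hi.add h1 ?_
    simp only [root_smul P w⁻¹, root_refl_self]
    rw [hk, neg_add, smul_add]

end Length

/-! ### The Bruhat order and its lifting property. -/

section Bruhat

variable {P : RootPairing ι ℝ M N} {b : P.Base}

theorem BruhatLE.eq_or_length_lt {u v : P.weylGroup} (h : BruhatLE b u v) :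
    u = v ∨ length b u < length b v := by
  induction h with
  | refl => exact Or.inl rfl
  | tail _ h ih => exact Or.inr (by obtain rfl | ih := ih; exacts [h.2, ih.trans h.2])

theorem BruhatLE.length_le {u v : P.weylGroup} (h : BruhatLE b u v) :
    length b u ≤ length b v := by
  obtain rfl | h := h.eq_or_length_lt
  exacts [le_rfl, h.le]

theorem BruhatLE.trans {u v w : P.weylGroup} (h : BruhatLE b u v) (h' : BruhatLE b v w) :
    BruhatLE b u w :=
  Relation.ReflTransGen.trans h h'

theorem bruhatLE_rfl (u : P.weylGroup) : BruhatLE b u u := Relation.ReflTransGen.refl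

theorem bruhatLE_refl_mul {u : P.weylGroup} {j : ι} (h : length b u < length b (refl P j * u)) :
    BruhatLE b u (refl P j * u) :=
  Relation.ReflTransGen.single ⟨⟨u⁻¹ • j, by rw [← refl_smul_mul, smul_inv_smul]⟩, h⟩

variable [Finite ι] [P.IsCrystallographic] [P.IsReduced]

/-- Multiplying on the left by the simple reflection `s_i` preserves each step `x → s_j x` of the
Bruhat order except those with `s_i = s_j`. -/
theorem bruhatLE_refl_mul_refl_mul (i : b.support) {x : P.weylGroup} {j : ι} (hj : b.IsPos j)
    (hji : j ≠ i.1) (h : length b x < length b (refl P j * x)) :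
    BruhatLE b (refl P i.1 * x) (refl P i.1 * (refl P j * x)) := by
  have e : refl P i.1 * (refl P j * x) = refl P (refl P i.1 • j) * (refl P i.1 * x) := by
    rw [refl_refl_smul]
    simp [mul_assoc]
  rw [e]
  apply bruhatLE_refl_mul
  rw [length_lt_refl_mul_iff hj] at h
  rw [length_lt_refl_mul_iff (isPos_refl_smul i.2 hj hji)]
  simpa [mul_smul] using h

/-- Steps of a chain other than x → s_i x survive left multiplication by s_i. After a step x → s_i
x, multiplication by s_i returns to x, which is already above u. -/
theorem BruhatLE.refl_mul_right {u v : P.weylGroup} (h : BruhatLE b u v) (i : b.support) :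
    BruhatLE b u (refl P i.1 * v) ∨ BruhatLE b (refl P i.1 * u) (refl P i.1 * v) := by
  induction h with
  | refl => exact Or.inr (bruhatLE_rfl _)
  | @tail x y hux hxy ih =>
    obtain ⟨⟨k, rfl⟩, hl⟩ := hxy
    -- The right reflection is rewritten as a left one, in whichever of ± x • k is positive.
    obtain ⟨j, hj, e⟩ : ∃ j, b.IsPos j ∧ x * refl P k = refl P j * x := by
      rcases em (b.IsPos (x • k)) with hp | hp
      · exact ⟨_, hp, (refl_smul_mul P x k).symm⟩
      · exact ⟨_, (isPos_refl_self b).mpr hp, by rw [refl_refl_self, refl_smul_mul]⟩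
    rw [e] at hl ⊢
    by_cases hji : j = i.1
    · subst hji
      rw [refl_mul_refl_mul]
      exact Or.inl hux
    · have h2 := bruhatLE_refl_mul_refl_mul i hj hji hl
      exact ih.imp (fun h => h.trans h2) (fun h => h.trans h2)

/-- The lifting property of the Bruhat order. -/
theorem BruhatLE.of_refl_mul {u v : P.weylGroup} {i : b.support}
    (hu : length b u < length b (refl P i.1 * u))
    (h : BruhatLE b (refl P i.1 * u) (refl P i.1 * v)) : BruhatLE b u v := by
  have h' := h.refl_mul_right i
  rw [refl_mul_refl_mul, refl_mul_refl_mul] at h'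
  exact h'.elim (bruhatLE_refl_mul hu).trans id

end Bruhat

/-! ### Degrees and primes in the symmetric algebra. -/

section SymmetricAlgebra

theorem range_ι_pow_map {κ : Type*} (B : Module.Basis κ ℝ M) (n : ℕ) :
    (LinearMap.range (SymmetricAlgebra.ι ℝ M) ^ n).map
      (SymmetricAlgebra.equivMvPolynomial B).toAlgHom.toLinearMap =
      MvPolynomial.homogeneousSubmodule κ ℝ n := by
  rw [Submodule.map_pow, ← MvPolynomial.homogeneousSubmodule_one_pow,
    MvPolynomial.homogeneousSubmodule_one_eq_span_X]
  congr 1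
  rw [LinearMap.range_eq_map, ← B.span_eq, Submodule.map_span, Submodule.map_span,
    ← Set.range_comp, ← Set.range_comp]
  congr 2
  funext k
  exact SymmetricAlgebra.equivMvPolynomial_ι_apply B k

theorem mem_range_ι_pow_iff {κ : Type*} (B : Module.Basis κ ℝ M) {n : ℕ}
    {x : SymmetricAlgebra ℝ M} :
    x ∈ LinearMap.range (SymmetricAlgebra.ι ℝ M) ^ n ↔
      (SymmetricAlgebra.equivMvPolynomial B x).IsHomogeneous n := by
  rw [← MvPolynomial.mem_homogeneousSubmodule, ← range_ι_pow_map B, Submodule.mem_map]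
  exact ⟨fun h => ⟨x, h, rfl⟩, fun ⟨y, hy, e⟩ =>
    (SymmetricAlgebra.equivMvPolynomial B).injective e ▸ hy⟩

instance isDomain_symmetricAlgebra : IsDomain (SymmetricAlgebra ℝ M) :=
  (SymmetricAlgebra.equivMvPolynomial (Module.Basis.ofVectorSpace ℝ M)).toMulEquiv.isDomain _

theorem eq_zero_of_dvd_of_lt {n m : ℕ} {x y : SymmetricAlgebra ℝ M}
    (hx : x ∈ LinearMap.range (SymmetricAlgebra.ι ℝ M) ^ n)
    (hy : y ∈ LinearMap.range (SymmetricAlgebra.ι ℝ M) ^ m) (hyx : y ∣ x) (h : n < m) : x = 0 := by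
  by_contra hx0
  obtain ⟨c, rfl⟩ := hyx
  have B := Module.Basis.ofVectorSpace ℝ M
  rw [mem_range_ι_pow_iff B] at hx hy
  have e := (SymmetricAlgebra.equivMvPolynomial B).injective
  obtain ⟨hy0, hc0⟩ := mul_ne_zero_iff.mp hx0
  have h1 := hx.totalDegree ((map_ne_zero_iff _ e).mpr hx0)
  have h2 := hy.totalDegree ((map_ne_zero_iff _ e).mpr hy0)
  rw [map_mul, MvPolynomial.totalDegree_mul_of_isDomain ((map_ne_zero_iff _ e).mpr hy0)
    ((map_ne_zero_iff _ e).mpr hc0)] at h1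
  omega

/-- In degree n + 1 the product is x times the degree n component of y; cancelling x identifies y
with that component. -/
theorem mem_range_ι_pow_of_mul_mem {n : ℕ} {x y : SymmetricAlgebra ℝ M}
    (hx : x ∈ LinearMap.range (SymmetricAlgebra.ι ℝ M)) (hx0 : x ≠ 0)
    (h : x * y ∈ LinearMap.range (SymmetricAlgebra.ι ℝ M) ^ (n + 1)) :
    y ∈ LinearMap.range (SymmetricAlgebra.ι ℝ M) ^ n := by
  have B := Module.Basis.ofVectorSpace ℝ M
  rw [← pow_one (LinearMap.range (SymmetricAlgebra.ι ℝ M))] at hx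
  rw [mem_range_ι_pow_iff B] at hx h ⊢
  have e := (SymmetricAlgebra.equivMvPolynomial B).injective
  have hx0' := (map_ne_zero_iff _ e).mpr hx0
  rw [map_mul] at h
  let _ := MvPolynomial.gradedAlgebra (σ := Module.Basis.ofVectorSpaceIndex ℝ M) (R := ℝ)
  have h1 := DirectSum.coe_decompose_mul_add_of_left_mem
    (MvPolynomial.homogeneousSubmodule (Module.Basis.ofVectorSpaceIndex ℝ M) ℝ) (j := n)
    (b := SymmetricAlgebra.equivMvPolynomial B y) hx
  rw [DirectSum.decompose_of_mem_same _ (by rwa [add_comm 1 n]), mul_right_inj' hx0'] at h1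
  rw [h1]
  exact SetLike.coe_mem (DirectSum.decompose (MvPolynomial.homogeneousSubmodule
    (Module.Basis.ofVectorSpaceIndex ℝ M) ℝ) (SymmetricAlgebra.equivMvPolynomial B y) n)

/-- Extending m to a basis turns it into a polynomial variable. -/
theorem prime_ι {m : M} (hm : m ≠ 0) : Prime (SymmetricAlgebra.ι ℝ M m) := by
  have hli : LinearIndepOn ℝ id ({m} : Set M) := LinearIndepOn.singleton hm
  have hmem : m ∈ hli.extend (Set.subset_univ _) := hli.subset_extend _ rfl
  have e : (Module.Basis.extend hli) ⟨m, hmem⟩ = m := Module.Basis.extend_apply_self hli _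
  rw [← MulEquiv.prime_iff (SymmetricAlgebra.equivMvPolynomial (Module.Basis.extend hli))]
  have h := SymmetricAlgebra.equivMvPolynomial_ι_apply (Module.Basis.extend hli) ⟨m, hmem⟩
  rw [e] at h
  rw [h]
  exact MvPolynomial.X_prime

/-- Otherwise a linear form killing m but not m' extends to an algebra map to ℝ that contradicts
divisibility. -/
theorem ι_dvd_ι {m m' : M} (h : SymmetricAlgebra.ι ℝ M m ∣ SymmetricAlgebra.ι ℝ M m') :
    m' ∈ Submodule.span ℝ {m} := by
  by_contra hm
  obtain ⟨φ, hφ, hle⟩ := Submodule.exists_le_ker_of_notMem hm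
  obtain ⟨c, hc⟩ := h
  have := congrArg (SymmetricAlgebra.lift φ) hc
  rw [map_mul, SymmetricAlgebra.lift_ι_apply, SymmetricAlgebra.lift_ι_apply,
    LinearMap.mem_ker.mp (hle (Submodule.mem_span_singleton_self m)), zero_mul] at this
  exact hφ this

end SymmetricAlgebra

/-! ### The Weyl group action on the symmetric algebra, and divisibility by roots. -/

section Action

variable (P : RootPairing ι ℝ M N)

theorem symAct_ι (w : P.weylGroup) (m : M) :
    symAct P w (SymmetricAlgebra.ι ℝ M m) = SymmetricAlgebra.ι ℝ M (w • m) :=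
  SymmetricAlgebra.lift_ι_apply _ _

theorem symAct_mul (v w : P.weylGroup) (x : Sym P) :
    symAct P (v * w) x = symAct P v (symAct P w x) := by
  refine DFunLike.congr_fun (f := symAct P (v * w)) (g := (symAct P v).comp (symAct P w)) ?_ x
  refine SymmetricAlgebra.algHom_ext (LinearMap.ext fun m => ?_)
  change symAct P (v * w) (SymmetricAlgebra.ι ℝ M m) =
    symAct P v (symAct P w (SymmetricAlgebra.ι ℝ M m))
  rw [symAct_ι, symAct_ι, symAct_ι, mul_smul]

@[simp]
theorem symAct_one (x : Sym P) : symAct P 1 x = x := by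
  refine DFunLike.congr_fun (f := symAct P 1) (g := AlgHom.id ℝ _) ?_ x
  refine SymmetricAlgebra.algHom_ext (LinearMap.ext fun m => ?_)
  change symAct P 1 (SymmetricAlgebra.ι ℝ M m) = _
  rw [symAct_ι, one_smul]
  rfl

@[simp]
theorem symAct_refl_refl (i : ι) (x : Sym P) : symAct P (refl P i) (symAct P (refl P i) x) = x := by
  rw [← symAct_mul, refl_mul_refl, symAct_one]

theorem symAct_mem_range_ι_pow (w : P.weylGroup) {n : ℕ} {x : Sym P}
    (hx : x ∈ LinearMap.range (SymmetricAlgebra.ι ℝ M) ^ n) :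
    symAct P w x ∈ LinearMap.range (SymmetricAlgebra.ι ℝ M) ^ n := by
  have h1 : (LinearMap.range (SymmetricAlgebra.ι ℝ M)).map (symAct P w).toLinearMap ≤
      LinearMap.range (SymmetricAlgebra.ι ℝ M) := by
    rintro _ ⟨_, ⟨m, rfl⟩, rfl⟩
    exact ⟨w • m, (symAct_ι P w m).symm⟩
  have h2 := Submodule.mem_map_of_mem (f := (symAct P w).toLinearMap) hx
  rw [Submodule.map_pow] at h2
  exact pow_le_pow_left' h1 n h2

theorem symRoot_refl_self (i : ι) : symRoot P (refl P i • i) = -symRoot P i := by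
  rw [symRoot, root_refl_self, map_neg, symRoot]

theorem symAct_refl_symRoot (i : ι) : symAct P (refl P i) (symRoot P i) = -symRoot P i := by
  rw [symAct_symRoot, symRoot_refl_self]

theorem symRoot_dvd_sub_symAct (i : ι) (x : Sym P) :
    symRoot P i ∣ x - symAct P (refl P i) x := by
  induction x using SymmetricAlgebra.induction with
  | algebraMap r => simp
  | ι m =>
    rw [symAct_ι, refl_smul_vec, P.reflection_apply, ← map_sub, sub_sub_cancel, map_smul]
    exact ⟨algebraMap ℝ _ _, by rw [mul_comm, ← Algebra.smul_def]; rfl⟩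
  | mul x y hx hy =>
    -- The twisted Leibniz rule.
    have : x * y - symAct P (refl P i) (x * y) = (x - symAct P (refl P i) x) * y +
        symAct P (refl P i) x * (y - symAct P (refl P i) y) := by
      rw [map_mul]; ring
    rw [this]
    exact dvd_add (hx.mul_right _) (hy.mul_left _)
  | add x y hx hy =>
    rw [map_add, add_sub_add_comm]
    exact dvd_add hx hy

theorem prime_symRoot (i : ι) : Prime (symRoot P i) := prime_ι (P.ne_zero i)

theorem symRoot_ne_zero (i : ι) : symRoot P i ≠ 0 := (prime_symRoot P i).ne_zero

theorem symRoot_mem_range_ι (i : ι) : symRoot P i ∈ LinearMap.range (SymmetricAlgebra.ι ℝ M) :=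
  ⟨_, rfl⟩

theorem eq_or_eq_of_symRoot_dvd [P.IsReduced] {i j : ι} (h : symRoot P i ∣ symRoot P j) :
    j = i ∨ j = refl P i • i := by
  by_contra! hne
  have h1 : LinearIndependent ℝ ![P.root i, P.root j] := by
    refine RootPairing.IsReduced.linearIndependent P hne.1.symm fun h => hne.2 ?_
    apply P.root.injective
    rw [root_refl_self, h, neg_neg]
  obtain ⟨c, hc⟩ := Submodule.mem_span_singleton.mp (ι_dvd_ι h)
  have := LinearIndependent.pair_iff.mp h1 c (-1) (by rw [hc]; simp)
  norm_num at this

theorem prod_symRoot_mem (s : Finset ι) :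
    ∏ i ∈ s, symRoot P i ∈ LinearMap.range (SymmetricAlgebra.ι ℝ M) ^ s.card := by
  classical
  induction s using Finset.induction_on with
  | empty => simp
  | insert a s ha ih =>
    rw [Finset.prod_insert ha, Finset.card_insert_of_notMem ha, pow_succ']
    exact Submodule.mul_mem_mul (symRoot_mem_range_ι P a) ih

theorem prod_symRoot_ne_zero (s : Finset ι) : ∏ i ∈ s, symRoot P i ≠ 0 :=
  Finset.prod_ne_zero_iff.mpr fun i _ => symRoot_ne_zero P i

variable {P} in
-- In a reduced system, distinct positive roots are pairwise non-associate primes.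
theorem prod_symRoot_dvd [P.IsReduced] (b : P.Base) {s : Finset ι} (hs : ∀ i ∈ s, b.IsPos i)
    {x : Sym P} (hx : ∀ i ∈ s, symRoot P i ∣ x) : ∏ i ∈ s, symRoot P i ∣ x := by
  classical
  induction s using Finset.induction_on with
  | empty => simp
  | insert a s ha ih =>
    obtain ⟨c, rfl⟩ := ih (fun i hi => hs i (Finset.mem_insert_of_mem hi))
      (fun i hi => hx i (Finset.mem_insert_of_mem hi))
    have h1 := ((prime_symRoot P a).dvd_or_dvd (hx a (Finset.mem_insert_self a s))).resolve_left
      fun h => by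
        obtain ⟨j, hj, hd⟩ := (prime_symRoot P a).exists_mem_finset_dvd h
        obtain rfl | rfl := eq_or_eq_of_symRoot_dvd P hd
        · exact ha hj
        · exact (isPos_refl_self b).mp (hs _ (Finset.mem_insert_of_mem hj))
            (hs _ (Finset.mem_insert_self _ _))
    rw [Finset.prod_insert ha, mul_comm]
    exact mul_dvd_mul_left _ h1

end Action

/-! ### Left divided differences and the action on classes. -/

section Cohomology

variable {P : RootPairing ι ℝ M N}

/-- Since v s_β = s_{vβ} v, the edges can be labelled by left reflections, the form suited to left
divided differences. -/
theorem mem_cohomology_iff {f : P.weylGroup → Sym P} :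
    f ∈ cohomology P ↔ ∀ (v : P.weylGroup) (j : ι), symRoot P j ∣ f (refl P j * v) - f v := by
  constructor
  · intro hf v j
    have h := hf v (v⁻¹ • j)
    rwa [← refl_smul_mul, smul_inv_smul] at h
  · intro hf v j
    have h := hf v (v • j)
    rwa [refl_smul_mul] at h

theorem symRoot_dvd_sub_symAct_refl_mul (i : ι) (f : cohomology P) (v : P.weylGroup) :
    symRoot P i ∣ f.1 v - symAct P (refl P i) (f.1 (refl P i * v)) := by
  have h1 := symRoot_dvd_sub_symAct P i (f.1 (refl P i * v))
  have h2 := mem_cohomology_iff.mp f.2 v i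
  simpa using dvd_sub h1 h2

/-- The values of the left divided difference `(f - f^{s_i}) / α_i`. -/
def divDiffFun (i : ι) (f : cohomology P) (v : P.weylGroup) : Sym P :=
  (symRoot_dvd_sub_symAct_refl_mul i f v).choose

theorem symRoot_mul_divDiffFun (i : ι) (f : cohomology P) (v : P.weylGroup) :
    symRoot P i * divDiffFun i f v = f.1 v - symAct P (refl P i) (f.1 (refl P i * v)) :=
  (symRoot_dvd_sub_symAct_refl_mul i f v).choose_spec.symm

/-- The numerator f - f^{s_i} and the denominator α_i both change sign under s_i. -/
theorem symAct_divDiffFun (i : ι) (f : cohomology P) (v : P.weylGroup) :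
    symAct P (refl P i) (divDiffFun i f (refl P i * v)) = divDiffFun i f v := by
  apply mul_left_cancel₀ (neg_ne_zero.mpr (symRoot_ne_zero P i))
  rw [← symAct_refl_symRoot, ← map_mul, symRoot_mul_divDiffFun, symAct_refl_symRoot, neg_mul,
    symRoot_mul_divDiffFun]
  simp

theorem divDiffFun_mem [P.IsReduced] (i : ι) (f : cohomology P) :
    divDiffFun i f ∈ cohomology P := by
  rw [mem_cohomology_iff]
  intro v j
  by_cases hji : symRoot P j ∣ symRoot P i
  -- If α_j = ± α_i, invariance makes the difference of the form x - s_i x, up to sign.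
  · have hij : refl P j = refl P i := by
      obtain rfl | rfl := eq_or_eq_of_symRoot_dvd P hji
      · rfl
      · exact (refl_refl_self P j).symm
    have hd : symRoot P i ∣ divDiffFun i f (refl P i * v) - divDiffFun i f v := by
      have h := symRoot_dvd_sub_symAct P i (divDiffFun i f (refl P i * v))
      rwa [symAct_divDiffFun] at h
    exact hij ▸ hji.trans hd
  -- Otherwise the prime α_j does not divide α_i, so divisibility may be checked after multiplying
  -- by α_i; s_i carries the edge label s_i α_j to α_j.
  · refine ((prime_symRoot P j).dvd_or_dvd ?_).resolve_left hji
    rw [mul_sub, symRoot_mul_divDiffFun, symRoot_mul_divDiffFun, sub_sub_sub_comm]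
    refine dvd_sub (mem_cohomology_iff.mp f.2 v j) ?_
    obtain ⟨c, hc⟩ := mem_cohomology_iff.mp f.2 (refl P i * v) (refl P i • j)
    have e : refl P (refl P i • j) * (refl P i * v) = refl P i * (refl P j * v) := by
      rw [refl_refl_smul]; simp [mul_assoc]
    rw [← map_sub, ← e, hc, map_mul, symAct_symRoot, refl_smul_refl_smul]
    exact dvd_mul_right _ _

/-- The left divided difference operator `f ↦ (f - f^{s_i}) / α_i` on classes. -/
def divDiff [P.IsReduced] (i : ι) (f : cohomology P) : cohomology P :=
  ⟨divDiffFun i f, divDiffFun_mem i f⟩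

theorem permute_refl [P.IsReduced] (i : ι) (f : cohomology P) :
    permute P (refl P i) f = f - symRoot P i • divDiff i f := by
  refine Subtype.ext (funext fun v => ?_)
  change symAct P (refl P i)⁻¹ (f.1 (refl P i * v)) = f.1 v - symRoot P i * divDiffFun i f v
  rw [symRoot_mul_divDiffFun, sub_sub_cancel, refl_inv]

theorem permute_refl_divDiff [P.IsReduced] (i : ι) (f : cohomology P) :
    permute P (refl P i) (divDiff i f) = divDiff i f := by
  refine Subtype.ext (funext fun v => ?_)
  change symAct P (refl P i)⁻¹ (divDiffFun i f (refl P i * v)) = divDiffFun i f v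
  rw [refl_inv, symAct_divDiffFun]

variable (P) in
/-- The action of an element of the Weyl group on classes, as an `ℝ`-linear map. -/
def permuteLinear (w : P.weylGroup) : cohomology P →ₗ[ℝ] cohomology P where
  toFun := permute P w
  map_add' f g := Subtype.ext (funext fun v => map_add (symAct P w⁻¹) (f.1 (w * v)) (g.1 (w * v)))
  map_smul' c f := Subtype.ext (funext fun v => map_smul (symAct P w⁻¹) c (f.1 (w * v)))

theorem permute_smul (w : P.weylGroup) (c : Sym P) (f : cohomology P) :
    permute P w (c • f) = symAct P w⁻¹ c • permute P w f :=
  Subtype.ext (funext fun v => map_mul (symAct P w⁻¹) c (f.1 (w * v)))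

/-- This is a right action, so a word acts starting from its first letter. -/
theorem permute_mul (v w : P.weylGroup) (f : cohomology P) :
    permute P (v * w) f = permute P w (permute P v f) := by
  refine Subtype.ext (funext fun x => ?_)
  change symAct P (v * w)⁻¹ (f.1 (v * w * x)) = symAct P w⁻¹ (symAct P v⁻¹ (f.1 (v * (w * x))))
  rw [mul_inv_rev, symAct_mul, mul_assoc]

theorem permute_one (f : cohomology P) : permute P 1 f = f := by
  refine Subtype.ext (funext fun x => ?_)
  change symAct P 1⁻¹ (f.1 (1 * x)) = f.1 x
  rw [inv_one, symAct_one, one_mul]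

theorem isInvariant_symmetrize [Finite ι] [P.IsRootSystem] (f : cohomology P) :
    IsInvariant P (symmetrize P f) := by
  intro v
  change permuteLinear P v (symmetrize P f) = symmetrize P f
  rw [symmetrize, map_smul, map_sum]
  congr 1
  refine Fintype.sum_equiv (Equiv.mulRight v) _ _ fun w => ?_
  exact (permute_mul w v f).symm

end Cohomology

/-! ### Existence, uniqueness and basis property of Schubert classes. -/

section Schubert

variable {P : RootPairing ι ℝ M N} {b : P.Base} [Finite ι] [P.IsCrystallographic] [P.IsReduced]

/-- If i is an inversion of u, then s_i u is shorter, f vanishes there, and the edge condition makes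
α_i divide f(u). -/
theorem prod_inversions_dvd {f : cohomology P} {u : P.weylGroup}
    (hf : ∀ v, length b v < length b u → f.1 v = 0) :
    ∏ i ∈ inversions b u, symRoot P i ∣ f.1 u := by
  refine prod_symRoot_dvd b (fun i hi => ((mem_inversions b).mp hi).1) fun i hi => ?_
  have hi' := (mem_inversions b).mp hi
  have h := mem_cohomology_iff.mp f.2 u i
  rwa [hf _ (length_refl_mul_lt hi'.1 hi'.2), zero_sub, dvd_neg] at h

theorem prod_inversions_mem (b : P.Base) (u : P.weylGroup) :
    ∏ i ∈ inversions b u, symRoot P i ∈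
      LinearMap.range (SymmetricAlgebra.ι ℝ M) ^ length b u :=
  card_inversions b u ▸ prod_symRoot_mem P (inversions b u)

/-- At a shortest v in the support, the value would have degree n and yet be divisible by a nonzero
element of degree ℓ(v) > n. -/
theorem eq_zero_of_homogeneous {f : cohomology P} {n : ℕ}
    (hf : ∀ v, f.1 v ∈ LinearMap.range (SymmetricAlgebra.ι ℝ M) ^ n)
    (hn : ∀ v, f.1 v ≠ 0 → n < length b v) : f = 0 := by
  have key : ∀ k v, length b v = k → f.1 v = 0 := by
    intro k
    induction k using Nat.strong_induction_on with
    | _ k ih =>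
      rintro v rfl
      by_contra hv
      exact hv (eq_zero_of_dvd_of_lt (hf v) (prod_inversions_mem b v)
        (prod_inversions_dvd fun x hx => ih _ hx x rfl) (hn v hv))
  exact Subtype.ext (funext fun v => key _ v rfl)

omit [P.IsCrystallographic] [P.IsReduced] in
theorem IsSchubertClass.eq_or_length_lt {u v : P.weylGroup} {f : cohomology P}
    (hf : IsSchubertClass b u f) (hv : f.1 v ≠ 0) : u = v ∨ length b u < length b v :=
  (hf.support v hv).eq_or_length_lt

theorem IsSchubertClass.unique {u : P.weylGroup} {f g : cohomology P}
    (hf : IsSchubertClass b u f) (hg : IsSchubertClass b u g) : f = g := by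
  rw [← sub_eq_zero]
  refine eq_zero_of_homogeneous (b := b) (n := length b u)
    (fun v => Submodule.sub_mem _ (hf.homogeneous v) (hg.homogeneous v)) fun v hv => ?_
  change f.1 v - g.1 v ≠ 0 at hv
  have h : u = v ∨ length b u < length b v := by
    by_cases hfv : f.1 v = 0
    · exact hg.eq_or_length_lt fun h => hv (by rw [hfv, h, sub_zero])
    · exact hf.eq_or_length_lt hfv
  refine h.resolve_left ?_
  rintro rfl
  exact hv (by rw [hf.normalized, hg.normalized, sub_self])

theorem IsSchubertClass.divDiff {u : P.weylGroup} {i : b.support} {f : cohomology P}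
    (hu : length b u < length b (refl P i.1 * u)) (hf : IsSchubertClass b (refl P i.1 * u) f) :
    IsSchubertClass b u (divDiff i.1 f) where
  homogeneous v := by
    refine mem_range_ι_pow_of_mul_mem (symRoot_mem_range_ι P i.1) (symRoot_ne_zero P i.1) ?_
    have e : symRoot P i.1 * (FlagGKM.divDiff i.1 f).1 v = _ := symRoot_mul_divDiffFun i.1 f v
    rw [e, ← length_refl_mul_eq hu]
    exact Submodule.sub_mem _ (hf.homogeneous v)
      (symAct_mem_range_ι_pow P _ (hf.homogeneous _))
  support v hv := by
    have e : symRoot P i.1 * (FlagGKM.divDiff i.1 f).1 v = _ := symRoot_mul_divDiffFun i.1 f v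
    by_cases h1 : f.1 v = 0
    -- With f(v) = 0, the term f(s_i v) is nonzero, and lifting turns s_i u ≤ s_i v into u ≤ v.
    · refine BruhatLE.of_refl_mul hu (hf.support _ fun h2 => ?_)
      rw [h1, h2, map_zero, sub_zero] at e
      exact (mul_ne_zero (symRoot_ne_zero P i.1) hv) e
    · exact (bruhatLE_refl_mul hu).trans (hf.support v h1)
  normalized := by
    classical
    have e : symRoot P i.1 * (FlagGKM.divDiff i.1 f).1 u = _ := symRoot_mul_divDiffFun i.1 f u
    have h1 : f.1 u = 0 := by
      by_contra h
      exact hu.not_ge (hf.support u h).length_le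
    rw [h1, hf.normalized, zero_sub, inversions_refl_mul hu,
      Finset.prod_insert notMem_image_inversions, map_mul, symAct_refl_symRoot, neg_mul, neg_neg,
      Finset.prod_image fun _ _ _ _ h => MulAction.injective _ h, map_prod] at e
    simpa [symAct_symRoot, symRoot_ne_zero P i.1] using e

/-- The class supported at the longest element of the Weyl group. -/
theorem exists_isSchubertClass_of_forall_length_le {u : P.weylGroup}
    (h : ∀ i : b.support, length b (refl P i.1 * u) ≤ length b u) :
    ∃ f : cohomology P, IsSchubertClass b u f := by
  classical
  -- Every positive root is an inversion of u, so every root divides the value at u and a function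
  -- concentrated at u meets all edge conditions.
  have hdvd : ∀ j, symRoot P j ∣ ∏ i ∈ inversions b u, symRoot P i := by
    intro j
    rcases em (b.IsPos j) with hj | hj
    · exact Finset.dvd_prod_of_mem _
        ((mem_inversions b).mpr ⟨hj, not_isPos_of_forall_length_le h hj⟩)
    · rw [← isPos_refl_self] at hj
      rw [← neg_dvd, ← symRoot_refl_self]
      exact Finset.dvd_prod_of_mem _
        ((mem_inversions b).mpr ⟨hj, not_isPos_of_forall_length_le h hj⟩)
  have hval : ∀ v j, symRoot P j ∣ (Pi.single u (∏ i ∈ inversions b u, symRoot P i) :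
      P.weylGroup → Sym P) v := by
    intro v j
    rw [Pi.single_apply]
    split_ifs
    · exact hdvd j
    · exact dvd_zero _
  refine ⟨⟨Pi.single u (∏ i ∈ inversions b u, symRoot P i),
    fun v i => dvd_sub (hval _ _) (hval _ _)⟩, ⟨fun v => ?_, fun v hv => ?_, ?_⟩⟩
  · change (Pi.single u _ : P.weylGroup → Sym P) v ∈ _
    rw [Pi.single_apply]
    split_ifs
    · exact prod_inversions_mem b u
    · exact Submodule.zero_mem _
  · have : v = u := by
      by_contra hne
      exact hv (Pi.single_eq_of_ne hne _)
    exact this.symm ▸ bruhatLE_rfl u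
  · exact Pi.single_eq_same u _

theorem length_le_card (b : P.Base) (w : P.weylGroup) : length b w ≤ Nat.card ι := by
  rw [← card_inversions]
  have := Fintype.ofFinite ι
  rw [Nat.card_eq_fintype_card]
  exact Finset.card_le_univ _

/-- Descending induction on length, which is bounded by the number of roots: if some s_i lengthens
u, take the divided difference of the class of s_i u. -/
theorem exists_isSchubertClass (b : P.Base) (u : P.weylGroup) :
    ∃ f : cohomology P, IsSchubertClass b u f := by
  generalize hn : Nat.card ι - length b u = n
  induction n using Nat.strong_induction_on generalizing u with
  | _ n ih =>
    by_cases h : ∀ i : b.support, length b (refl P i.1 * u) ≤ length b u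
    · exact exists_isSchubertClass_of_forall_length_le h
    · push Not at h
      obtain ⟨i, hi⟩ := h
      have := length_le_card b (refl P i.1 * u)
      obtain ⟨f, hf⟩ := ih _ (by omega) (refl P i.1 * u) rfl
      exact ⟨_, hf.divDiff hi⟩

theorem existsUnique_isSchubertClass (b : P.Base) (u : P.weylGroup) :
    ∃! f : cohomology P, IsSchubertClass b u f := by
  obtain ⟨f, hf⟩ := exists_isSchubertClass b u
  exact ⟨f, hf, fun g hg => hg.unique hf⟩

theorem isSchubertClass_schubertClass (b : P.Base) (u : P.weylGroup) :
    IsSchubertClass b u (schubertClass b u) := by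
  rw [schubertClass, dif_pos (exists_isSchubertClass b u)]
  exact (exists_isSchubertClass b u).choose_spec

theorem divDiff_schubertClass {u : P.weylGroup} {i : b.support}
    (hu : length b u < length b (refl P i.1 * u)) :
    divDiff i.1 (schubertClass b (refl P i.1 * u)) = schubertClass b u :=
  ((isSchubertClass_schubertClass b _).divDiff hu).unique (isSchubertClass_schubertClass b u)

theorem permute_refl_schubertClass_of_lt {u : P.weylGroup} {i : b.support}
    (hu : length b u < length b (refl P i.1 * u)) :
    permute P (refl P i.1) (schubertClass b u) = schubertClass b u := by
  rw [← divDiff_schubertClass hu, permute_refl_divDiff]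

theorem permute_refl_schubertClass_of_gt {u : P.weylGroup} {i : b.support}
    (hu : length b (refl P i.1 * u) < length b u) :
    permute P (refl P i.1) (schubertClass b u) =
      schubertClass b u - symRoot P i.1 • schubertClass b (refl P i.1 * u) := by
  have h := divDiff_schubertClass (u := refl P i.1 * u) (i := i) (by simpa using hu)
  rw [refl_mul_refl_mul] at h
  rw [permute_refl, h]

theorem schubertClass_apply_self_ne_zero (b : P.Base) (u : P.weylGroup) :
    (schubertClass b u).1 u ≠ 0 := by
  rw [(isSchubertClass_schubertClass b u).normalized]
  exact prod_symRoot_ne_zero P _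

theorem schubertClass_apply_eq_zero {u v : P.weylGroup} (hne : u ≠ v)
    (h : length b v ≤ length b u) : (schubertClass b u).1 v = 0 := by
  by_contra hv
  exact h.not_gt (((isSchubertClass_schubertClass b u).eq_or_length_lt hv).resolve_left hne)

omit [Finite ι] [P.IsCrystallographic] [P.IsReduced] in
theorem sum_smul_apply (s : Finset P.weylGroup) (c : P.weylGroup → Sym P)
    (g : P.weylGroup → cohomology P) (v : P.weylGroup) :
    (∑ u ∈ s, c u • g u).1 v = ∑ u ∈ s, c u * (g u).1 v := by
  rw [← Submodule.subtype_apply, map_sum, Finset.sum_apply]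
  rfl

variable [P.IsRootSystem]

theorem linearIndependent_schubertClass (b : P.Base) :
    LinearIndependent (Sym P) (schubertClass b) := by
  rw [Fintype.linearIndependent_iff]
  intro c hc
  have key : ∀ k u, length b u = k → c u = 0 := by
    intro k
    induction k using Nat.strong_induction_on with
    | _ k ih =>
      rintro u rfl
      have h := congrFun (congrArg Subtype.val hc) u
      rw [sum_smul_apply, Finset.sum_eq_single u] at h
      · exact (mul_eq_zero.mp h).resolve_right (schubertClass_apply_self_ne_zero b u)
      · intro v _ hvu
        rcases lt_or_ge (length b v) (length b u) with hl | hl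
        · rw [ih _ hl v rfl, zero_mul]
        · rw [schubertClass_apply_eq_zero hvu hl, mul_zero]
      · exact fun h => absurd (Finset.mem_univ u) h
  exact fun u => key _ u rfl

theorem mem_span_schubertClass (b : P.Base) (f : cohomology P) :
    f ∈ Submodule.span (Sym P) (Set.range (schubertClass b)) := by
  classical
  -- Values are cleared length by length: f vanishes in lengths below n, and for k = 0 the bound n
  -- exceeds every length.
  have key : ∀ k n, n + k = Nat.card ι + 1 → ∀ f : cohomology P,
      (∀ v, length b v < n → f.1 v = 0) →
      f ∈ Submodule.span (Sym P) (Set.range (schubertClass b)) := by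
    intro k
    induction k with
    | zero =>
      intro n hn f hf
      have : f = 0 := Subtype.ext (funext fun v => hf v (by have := length_le_card b v; omega))
      exact this ▸ Submodule.zero_mem _
    | succ k ih =>
      intro n hn f hf
      have hdvd : ∀ v, ∃ c, length b v = n → f.1 v = c * (schubertClass b v).1 v := by
        intro v
        by_cases hv : length b v = n
        · obtain ⟨c, hc⟩ := prod_inversions_dvd (b := b) (f := f) (u := v) (hv ▸ hf)
          exact ⟨c, fun _ => by
            rw [hc, (isSchubertClass_schubertClass b v).normalized, mul_comm]⟩
        · exact ⟨0, fun h => absurd h hv⟩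
      choose c hc using hdvd
      set g := ∑ u ∈ Finset.univ.filter (fun u => length b u = n), c u • schubertClass b u with hg
      have hmem : g ∈ Submodule.span (Sym P) (Set.range (schubertClass b)) :=
        Submodule.sum_mem _ fun u _ =>
          Submodule.smul_mem _ _ (Submodule.subset_span (Set.mem_range_self u))
      rw [← Submodule.sub_mem_iff_left _ hmem]
      refine ih (n + 1) (by omega) _ fun v hv => ?_
      change f.1 v - g.1 v = 0
      rw [hg, sum_smul_apply]
      rcases Nat.lt_succ_iff_lt_or_eq.mp hv with hv | hv
      · rw [hf v hv, Finset.sum_eq_zero, sub_zero]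
        intro u hu
        have hu := (Finset.mem_filter.mp hu).2
        rw [schubertClass_apply_eq_zero (by rintro rfl; omega) (by omega), mul_zero]
      · rw [Finset.sum_eq_single v, ← hc v hv, sub_self]
        · intro u hu huv
          have hu := (Finset.mem_filter.mp hu).2
          rw [schubertClass_apply_eq_zero huv (by omega), mul_zero]
        · exact fun h => absurd (Finset.mem_filter.mpr ⟨Finset.mem_univ v, hv⟩) h
  exact key _ 0 (Nat.zero_add _) f fun v hv => absurd hv (Nat.not_lt_zero _)

/-- The basis of equivariant Schubert classes. -/
def schubertBasis (b : P.Base) : Module.Basis P.weylGroup (Sym P) (cohomology P) :=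
  Module.Basis.mk (linearIndependent_schubertClass b) fun f _ => mem_span_schubertClass b f

@[simp]
theorem schubertBasis_apply (b : P.Base) (u : P.weylGroup) :
    schubertBasis b u = schubertClass b u := by
  simp [schubertBasis]

end Schubert

/-! ### Triangularity of symmetrization for the left weak order. -/

section Symmetrization

variable {P : RootPairing ι ℝ M N} {b : P.Base} [Finite ι] [P.IsCrystallographic] [P.IsReduced]

omit [Finite ι] [P.IsCrystallographic] [P.IsReduced] in
theorem leftWeakLE_refl (b : P.Base) (u : P.weylGroup) : LeftWeakLE b u u := by
  simp [LeftWeakLE]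

theorem LeftWeakLE.length_lt {v u : P.weylGroup} (h : LeftWeakLE b v u) (hne : v ≠ u) :
    length b v < length b u := by
  unfold LeftWeakLE at h
  have : length b (u * v⁻¹) ≠ 0 := fun h0 =>
    hne (mul_inv_eq_one.mp (eq_one_of_length_eq_zero h0)).symm
  omega

/-- Subadditivity bounds ℓ(u v⁻¹ s_i) above by ℓ(u v⁻¹) + 1 and below by ℓ(u) - ℓ(s_i v); these
agree. -/
theorem LeftWeakLE.refl_mul {v u : P.weylGroup} {i : b.support} (h : LeftWeakLE b v u)
    (hv : length b (refl P i.1 * v) < length b v) : LeftWeakLE b (refl P i.1 * v) u := by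
  unfold LeftWeakLE at h ⊢
  have h1 := length_mul_le b (u * (refl P i.1 * v)⁻¹) (refl P i.1 * v)
  have h2 := length_mul_le b (u * v⁻¹) (refl P i.1)
  have h3 := length_refl_mul_le b i 1
  have h4 := length_le_refl_mul b i v
  rw [inv_mul_cancel_right] at h1
  rw [mul_one, length_one] at h3
  have e : u * (refl P i.1 * v)⁻¹ = u * v⁻¹ * refl P i.1 := by simp [mul_assoc]
  rw [e] at h1 ⊢
  omega

/-- The span of the Schubert classes strictly below `u` in the left weak order. -/
def spanBelow (b : P.Base) (u : P.weylGroup) : Submodule (Sym P) (cohomology P) :=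
  Submodule.span (Sym P) (schubertClass b '' {v | LeftWeakLE b v u ∧ v ≠ u})

theorem schubertClass_refl_mul_mem_spanBelow {u v : P.weylGroup} {i : b.support}
    (h : LeftWeakLE b v u) (hv : length b (refl P i.1 * v) < length b v) :
    schubertClass b (refl P i.1 * v) ∈ spanBelow b u := by
  refine Submodule.subset_span ⟨_, ⟨h.refl_mul hv, ?_⟩, rfl⟩
  rintro rfl
  by_cases hne : v = refl P i.1 * v
  · exact hv.ne (congrArg _ hne.symm)
  · exact hv.not_gt (h.length_lt hne)

/-- The difference is 0 or -α_i τ_{s_i v}. The case v = u is included: the correction is still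
strictly below u. -/
theorem permute_refl_schubertClass_sub_mem {u v : P.weylGroup} (i : b.support)
    (h : LeftWeakLE b v u) :
    permute P (refl P i.1) (schubertClass b v) - schubertClass b v ∈ spanBelow b u := by
  rcases em (b.IsPos (v⁻¹ • i.1)) with hv | hv
  · rw [← length_lt_refl_mul_iff (b.isPos_of_mem_support i.2)] at hv
    rw [permute_refl_schubertClass_of_lt hv, sub_self]
    exact Submodule.zero_mem _
  · rw [← length_refl_mul_lt_iff (b.isPos_of_mem_support i.2)] at hv
    rw [permute_refl_schubertClass_of_gt hv, sub_sub_cancel_left]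
    exact Submodule.neg_mem _ (Submodule.smul_mem _ _ (schubertClass_refl_mul_mem_spanBelow h hv))

theorem permute_refl_mem_spanBelow {u : P.weylGroup} (i : b.support) {f : cohomology P}
    (hf : f ∈ spanBelow b u) : permute P (refl P i.1) f ∈ spanBelow b u := by
  induction hf using Submodule.span_induction with
  | mem f hf =>
    obtain ⟨v, hv, rfl⟩ := hf
    have h1 : schubertClass b v ∈ spanBelow b u := Submodule.subset_span ⟨v, hv, rfl⟩
    exact (Submodule.sub_mem_iff_left _ h1).mp (permute_refl_schubertClass_sub_mem i hv.1)
  | zero =>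
    have : permute P (refl P i.1) 0 = 0 := map_zero (permuteLinear P (refl P i.1))
    rw [this]
    exact Submodule.zero_mem _
  | add f g _ _ hf hg =>
    have : permute P (refl P i.1) (f + g) = permute P (refl P i.1) f + permute P (refl P i.1) g :=
      map_add (permuteLinear P (refl P i.1)) f g
    rw [this]
    exact Submodule.add_mem _ hf hg
  | smul c f _ hf =>
    rw [permute_smul]
    exact Submodule.smul_mem _ _ hf

theorem permute_schubertClass_sub_mem (b : P.Base) (u w : P.weylGroup) :
    permute P w (schubertClass b u) - schubertClass b u ∈ spanBelow b u := by
  obtain ⟨l, rfl⟩ := exists_word b w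
  induction l using List.reverseRecOn with
  | nil =>
    rw [wordProd_nil, permute_one, sub_self]
    exact Submodule.zero_mem _
  | append_singleton l i ih =>
    have h1 := permute_refl_mem_spanBelow i ih
    have h2 : permute P (refl P i.1) (permute P (wordProd b l) (schubertClass b u) -
        schubertClass b u) = permute P (refl P i.1) (permute P (wordProd b l) (schubertClass b u)) -
        permute P (refl P i.1) (schubertClass b u) := map_sub (permuteLinear P (refl P i.1)) _ _
    -- Uses τ^{w s_i} - τ = (τ^w - τ)^{s_i} + (τ^{s_i} - τ).
    have h3 := Submodule.add_mem _ (h2 ▸ h1)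
      (permute_refl_schubertClass_sub_mem i (leftWeakLE_refl b u))
    rw [sub_add_sub_cancel] at h3
    rwa [wordProd_append, wordProd_cons, wordProd_nil, mul_one, permute_mul]

variable [P.IsRootSystem]

theorem symmetrize_schubertClass_sub_mem (b : P.Base) (u : P.weylGroup) :
    symmetrize P (schubertClass b u) - schubertClass b u ∈ spanBelow b u := by
  have h0 : (Fintype.card P.weylGroup : ℝ) ≠ 0 := by simp
  have e : symmetrize P (schubertClass b u) - schubertClass b u =
      (Fintype.card P.weylGroup : ℝ)⁻¹ •
        ∑ w : P.weylGroup, (permute P w (schubertClass b u) - schubertClass b u) := by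
    rw [symmetrize, Finset.sum_sub_distrib, smul_sub, Finset.sum_const, Finset.card_univ,
      ← Nat.cast_smul_eq_nsmul ℝ, smul_smul, inv_mul_cancel₀ h0, one_smul]
  rw [e]
  exact Submodule.smul_of_tower_mem _ _
    (Submodule.sum_mem _ fun w _ => permute_schubertClass_sub_mem b u w)

theorem schubertBasis_repr_symmetrize_sub {u v : P.weylGroup}
    (h : (schubertBasis b).repr (symmetrize P (schubertClass b u) - schubertClass b u) v ≠ 0) :
    LeftWeakLE b v u ∧ v ≠ u := by
  have h1 := symmetrize_schubertClass_sub_mem b u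
  have e : schubertClass b = schubertBasis b := funext fun u => (schubertBasis_apply b u).symm
  rw [spanBelow, e, Module.Basis.mem_span_image] at h1
  rw [e] at h
  exact h1 (Finsupp.mem_support_iff.mpr h)

theorem schubertBasis_repr_symmetrize_self (b : P.Base) (u : P.weylGroup) :
    (schubertBasis b).repr (symmetrize P (schubertClass b u)) u = 1 := by
  have h1 : (schubertBasis b).repr (symmetrize P (schubertClass b u) - schubertClass b u) u = 0 :=
    not_not.mp fun h => (schubertBasis_repr_symmetrize_sub h).2 rfl
  rw [map_sub, Finsupp.sub_apply, sub_eq_zero] at h1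
  rw [h1, ← schubertBasis_apply, Module.Basis.repr_self, Finsupp.single_eq_same]

theorem leftWeakLE_of_schubertBasis_repr_ne_zero {u v : P.weylGroup}
    (h : (schubertBasis b).repr (symmetrize P (schubertClass b u)) v ≠ 0) :
    LeftWeakLE b v u := by
  by_cases hvu : v = u
  · exact hvu ▸ leftWeakLE_refl b v
  · refine (schubertBasis_repr_symmetrize_sub (v := v) ?_).1
    rw [map_sub, Finsupp.sub_apply, ← schubertBasis_apply b u, Module.Basis.repr_self,
      Finsupp.single_eq_of_ne hvu, sub_zero, schubertBasis_apply]
    exact h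

/-- Inverts the unitriangular system by induction on length. -/
theorem schubertClass_mem_span_symmetrize (b : P.Base) (u : P.weylGroup) :
    schubertClass b u ∈
      Submodule.span (Sym P) (Set.range fun u => symmetrize P (schubertClass b u)) := by
  generalize hn : length b u = n
  induction n using Nat.strong_induction_on generalizing u with
  | _ n ih =>
    have h1 : spanBelow b u ≤
        Submodule.span (Sym P) (Set.range fun u => symmetrize P (schubertClass b u)) := by
      refine Submodule.span_le.mpr ?_
      rintro _ ⟨v, hv, rfl⟩
      exact ih _ (hn ▸ hv.1.length_lt hv.2) v rfl
    refine (Submodule.sub_mem_iff_right _ ?_).mp (h1 (symmetrize_schubertClass_sub_mem b u))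
    exact Submodule.subset_span (Set.mem_range_self u)

theorem exists_basis_symmetrize (b : P.Base) :
    ∃ B' : Module.Basis P.weylGroup (Sym P) (cohomology P),
      ∀ u, B' u = symmetrize P (schubertClass b u) := by
  let T : cohomology P →ₗ[Sym P] cohomology P :=
    (schubertBasis b).constr (Sym P) fun u => symmetrize P (schubertClass b u)
  have hT : Function.Surjective T := by
    rw [← LinearMap.range_eq_top, Module.Basis.constr_range, eq_top_iff,
      ← (schubertBasis b).span_eq, Submodule.span_le]
    rintro _ ⟨u, rfl⟩
    rw [schubertBasis_apply]
    exact schubertClass_mem_span_symmetrize b u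
  have : Module.Finite (Sym P) (cohomology P) := Module.Finite.of_basis (schubertBasis b)
  -- A surjective endomorphism of a finite module over a commutative ring is injective, so spanning
  -- suffices.
  have hT' : Function.Injective T := OrzechProperty.injective_of_surjective_endomorphism T hT
  refine ⟨(schubertBasis b).map (LinearEquiv.ofBijective T ⟨hT', hT⟩), fun u => ?_⟩
  rw [Module.Basis.map_apply]
  exact (schubertBasis b).constr_basis (Sym P) _ u

end Symmetrization

end FlagGKM

end

theorem mainTheorem8 {ι M N : Type*} [Finite ι]
    [AddCommGroup M] [Module ℝ M] [AddCommGroup N] [Module ℝ N]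
    (P : RootPairing ι ℝ M N) [P.IsRootSystem] [P.IsCrystallographic] [P.IsReduced]
    (b : P.Base) :
    -- the Schubert classes are well defined
    (∀ u : P.weylGroup, ∃! f : FlagGKM.cohomology P, FlagGKM.IsSchubertClass b u f) ∧
    -- they form a basis, in which the symmetrized classes have a unitriangular matrix
    (∃ B : Module.Basis P.weylGroup (FlagGKM.Sym P) (FlagGKM.cohomology P),
      (∀ u, B u = FlagGKM.schubertClass b u) ∧
      (∀ u v, B.repr (FlagGKM.symmetrize P (FlagGKM.schubertClass b u)) v ≠ 0 →
        FlagGKM.LeftWeakLE b v u) ∧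
      (∀ u, B.repr (FlagGKM.symmetrize P (FlagGKM.schubertClass b u)) u = 1)) ∧
    -- the symmetrized classes form a basis and are invariant
    (∃ B' : Module.Basis P.weylGroup (FlagGKM.Sym P) (FlagGKM.cohomology P),
      ∀ u, B' u = FlagGKM.symmetrize P (FlagGKM.schubertClass b u)) ∧
    (∀ u, FlagGKM.IsInvariant P (FlagGKM.symmetrize P (FlagGKM.schubertClass b u))) :=
  ⟨FlagGKM.existsUnique_isSchubertClass b,
    ⟨FlagGKM.schubertBasis b, FlagGKM.schubertBasis_apply b,
      fun _ _ => FlagGKM.leftWeakLE_of_schubertBasis_repr_ne_zero,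
      FlagGKM.schubertBasis_repr_symmetrize_self b⟩,
    FlagGKM.exists_basis_symmetrize b,
    fun _ => FlagGKM.isInvariant_symmetrize _⟩
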